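/- Let $n\ge 1$ and let $s=(s_1,\dots,s_n)$ be a sequence of independent random variables, each uniformly distributed on $\{1,\dots,n\}$. The algorithm Linear sets $g\leftarrow$ True; then for $i=1,\dots,n$ it sets $v_i\leftarrow 0$; then for $i=1,\dots,n$ it tests whether $v_{s_i}>0$, and if so sets $g\leftarrow$ False and returns $g$, otherwise sets $v_{s_i}\leftarrow v_{s_i}+1$; after the last loop it returns $g$. Its running time is the number of these assignments (to $g$ and to entries of $v$) plus the number of these comparisons $v_{s_i}>0$ (the administration of the loop variable is not counted). Put $$\kappa(n)=\frac13-\sqrt{\frac{\pi n}{2}}+\sum_{k=1}^{n}\frac{n!\,k^2}{(n-k)!\,n^{k+1}},\qquad \delta(n)=\kappa(n)-\frac{n!}{n^n}.$$ Then the expected running time $T_L(n)$ of Linear is $$T_L(n)=n+\sqrt{2\pi n}+\frac73+2\,\delta(n)\qquad(n\ge 1),$$ where $\delta(n)\to 0$ as $n\to\infty$. Moreover, $\delta(n+1)>\delta(n)$ for $1\le n\le 7$ and $\delta(n+1)<\delta(n)$ for all $n\ge 8$. -/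

import Mathlib

open MeasureTheory ProbabilityTheory Filter Topology
open scoped Nat

namespace LinearTest

/-- A configuration of the algorithm `Linear` on sequences of length `n`: the logical variable `g`,
the working vector `v` (indexed by the `n` possible values of the input elements), and the numbers
of assignments and of comparisons carried out so far. -/
structure Config (n : ℕ) where
  g : Bool
  v : Fin n → ℕ
  assignments : ℕ
  comparisons : ℕ

/-- The assignment `g ← b`. -/
def Config.assignG {n : ℕ} (c : Config n) (b : Bool) : Config n :=
  { c with g := b, assignments := c.assignments + 1 }

/-- The assignment `v_k ← a`. -/
def Config.assignV {n : ℕ} (c : Config n) (k : Fin n) (a : ℕ) : Config n :=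
  { c with v := Function.update c.v k a, assignments := c.assignments + 1 }

/-- The cost of one comparison. -/
def Config.tickComparison {n : ℕ} (c : Config n) : Config n :=
  { c with comparisons := c.comparisons + 1 }

/-- First loop: for every `i` in the list, `v_i ← 0`. -/
def clearLoop {n : ℕ} : List (Fin n) → Config n → Config n
  | [], c => c
  | i :: is, c => clearLoop is (c.assignV i 0)

/-- Second loop: for every `i` in the list, if `v_{s_i} > 0` then `g ← False` and return, else
`v_{s_i} ← v_{s_i} + 1` and go on. -/
def testLoop {n : ℕ} (s : Fin n → Fin n) : List (Fin n) → Config n → Config n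
  | [], c => c
  | i :: is, c =>
    if 0 < c.v (s i) then
      c.tickComparison.assignG false
    else
      testLoop s is (c.tickComparison.assignV (s i) (c.v (s i) + 1))

/-- The algorithm `Linear` on the input `s`, started with arbitrary contents `g₀`, `v₀` of the
variables: `g ← True`, then the first loop and the second loop, each for `i` from first to last.
The output is the component `g` of the final configuration. -/
def run {n : ℕ} (g₀ : Bool) (v₀ : Fin n → ℕ) (s : Fin n → Fin n) : Config n :=
  testLoop s (List.finRange n)
    (clearLoop (List.finRange n)
      (Config.assignG { g := g₀, v := v₀, assignments := 0, comparisons := 0 } true))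

/-- The running time of `Linear`: the number of assignments plus the number of comparisons. -/
def runningTime {n : ℕ} (g₀ : Bool) (v₀ : Fin n → ℕ) (s : Fin n → Fin n) : ℕ :=
  (run g₀ v₀ s).assignments + (run g₀ v₀ s).comparisons

/-- `κ(n) = 1/3 - √(πn/2) + ∑_{k=1}^n n! k² / ((n-k)! n^{k+1})`. -/
noncomputable def kappa (n : ℕ) : ℝ :=
  1 / 3 - √(Real.pi * n / 2) +
    ∑ k ∈ Finset.Icc 1 n, ((n ! : ℝ) * (k : ℝ) ^ 2) / (((n - k)! : ℝ) * (n : ℝ) ^ (k + 1))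

/-- `δ(n) = κ(n) - n! / n^n`. -/
noncomputable def delta (n : ℕ) : ℝ :=
  kappa n - (n ! : ℝ) / (n : ℝ) ^ n

end LinearTest

/-!
`Linear` makes its `(j + 1)`-st comparison exactly when the first `j` inputs are pairwise distinct,
and every comparison is followed by one assignment, whatever its outcome. Hence the expected running
time is `n + 1` plus twice the sum over `j < n` of the birthday probabilities
`n (n - 1) ⋯ (n - j + 1) / n ^ j`, and the sum in `κ(n)` telescopes to these probabilities.

Expanding `(1 + y) ^ n` turns their sum over `j ≤ n` into the Laplace integral
`n * ∫ exp (-n * ψ y) dy` over `y > 0`, with `ψ y = y - log (1 + y)`. With `u = √(2 * ψ y)`, the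
terms `1` and `√(π * n / 2)` are the integrals of `n * exp (-n * ψ y)` against `dψ` and `du`. An
integration by parts then gives `κ(n) = ∫ exp (-n * ψ y) * K y dy`, where
`K = d/dy (1 / y - 1 / u)` is integrable and, by Bernoulli's inequality, nonnegative. So `κ`
decreases to `0`. Its decrement on `[n, n + 1]` is at least a constant times `(2 / e) ^ n`, whereas
`n! / n ^ n` shrinks by a factor of at least `2` at each step. For `n ≥ 16` this makes `δ` decrease;
for smaller `n`, squaring away the square roots reduces the comparison of `δ(n)` and `δ(n + 1)` to
rational bounds for `π`.
-/

namespace LinearTest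

section Calculus

theorem le_of_hasDerivAt_le {f g f' g' : ℝ → ℝ} {a x : ℝ} (hax : a ≤ x) (ha : f a ≤ g a)
    (hf : ∀ y, a ≤ y → HasDerivAt f (f' y) y) (hg : ∀ y, a ≤ y → HasDerivAt g (g' y) y)
    (h : ∀ y, a ≤ y → f' y ≤ g' y) : f x ≤ g x :=
  image_le_of_deriv_right_le_deriv_boundary (b := x)
    (fun y hy => (hf y hy.1).continuousAt.continuousWithinAt)
    (fun y hy => (hf y hy.1).hasDerivWithinAt) ha
    (fun y hy => (hg y hy.1).continuousAt.continuousWithinAt)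
    (fun y hy => (hg y hy.1).hasDerivWithinAt) (fun y hy => h y hy.1) ⟨hax, le_rfl⟩

theorem integrableOn_Ioi_deriv_of_nonneg_of_tendsto {g g' : ℝ → ℝ} {a m l : ℝ}
    (hderiv : ∀ x ∈ Set.Ioi a, HasDerivAt g (g' x) x) (hpos : ∀ x ∈ Set.Ioi a, 0 ≤ g' x)
    (ha : Tendsto g (𝓝[>] a) (𝓝 m)) (htop : Tendsto g atTop (𝓝 l)) :
    IntegrableOn g' (Set.Ioi a) := by
  refine integrableOn_Ioi_deriv_of_nonneg (g := Function.update g a m) (l := l) ?_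
    (fun x hx => ?_) hpos (htop.congr' ?_)
  · rwa [continuousWithinAt_update_same, Set.Ici_sdiff_left]
  · refine (hderiv x hx).congr_of_eventuallyEq ?_
    filter_upwards [isOpen_Ioi.mem_nhds hx] with y hy
    exact Function.update_of_ne (ne_of_gt hy) _ _
  · filter_upwards [eventually_gt_atTop a] with y hy
    exact (Function.update_of_ne hy.ne' _ _).symm

section ChangeOfVariables

variable {f f' g : ℝ → ℝ} {a : ℝ}

theorem image_Ioi_eq_Ioi (hmono : StrictMonoOn f (Set.Ici a)) (hcont : ContinuousOn f (Set.Ici a))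
    (htop : Tendsto f atTop atTop) : f '' Set.Ioi a = Set.Ioi (f a) := by
  refine Set.Subset.antisymm ?_ (intermediate_value_Ioi hcont htop)
  rintro _ ⟨x, hx, rfl⟩
  exact hmono Set.self_mem_Ici (Set.Ioi_subset_Ici_self hx) hx

theorem integrableOn_Ioi_deriv_mul_comp (hmono : StrictMonoOn f (Set.Ici a))
    (hcont : ContinuousOn f (Set.Ici a)) (hderiv : ∀ x ∈ Set.Ioi a, HasDerivAt f (f' x) x)
    (htop : Tendsto f atTop atTop) (hg : IntegrableOn g (Set.Ioi (f a))) :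
    IntegrableOn (fun x => f' x * g (f x)) (Set.Ioi a) :=
  (integrableOn_image_iff_integrableOn_deriv_smul_of_monotoneOn measurableSet_Ioi
    (fun x hx => (hderiv x hx).hasDerivWithinAt)
    (hmono.monotoneOn.mono Set.Ioi_subset_Ici_self) g).1
    (by rwa [image_Ioi_eq_Ioi hmono hcont htop])

theorem integral_Ioi_deriv_mul_comp (hmono : StrictMonoOn f (Set.Ici a))
    (hcont : ContinuousOn f (Set.Ici a)) (hderiv : ∀ x ∈ Set.Ioi a, HasDerivAt f (f' x) x)
    (htop : Tendsto f atTop atTop) :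
    ∫ x in Set.Ioi a, f' x * g (f x) = ∫ u in Set.Ioi (f a), g u := by
  rw [← image_Ioi_eq_Ioi hmono hcont htop]
  exact (integral_image_eq_integral_deriv_smul_of_monotoneOn measurableSet_Ioi
    (fun x hx => (hderiv x hx).hasDerivWithinAt)
    (hmono.monotoneOn.mono Set.Ioi_subset_Ici_self) g).symm

end ChangeOfVariables

end Calculus

section LaplaceTransform

variable {α : Type*} [MeasurableSpace α] {μ : Measure α} {f k : α → ℝ}

theorem norm_exp_neg_mul_le_one {c t : ℝ} (hc : 0 ≤ c) (ht : 0 ≤ t) :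
    ‖Real.exp (-(c * t))‖ ≤ 1 := by
  rw [Real.norm_of_nonneg (Real.exp_nonneg _)]
  exact Real.exp_le_one_iff.2 (neg_nonpos.2 (mul_nonneg hc ht))

theorem integrable_exp_neg_mul_mul {c : ℝ} (hc : 0 ≤ c) (hf : AEStronglyMeasurable f μ)
    (hf0 : 0 ≤ᵐ[μ] f) (hk : Integrable k μ) :
    Integrable (fun x => Real.exp (-(c * f x)) * k x) μ :=
  hk.bdd_mul (c := 1) (Real.continuous_exp.comp_aestronglyMeasurable (hf.const_mul c).neg)
    (hf0.mono fun _ hx => norm_exp_neg_mul_le_one hc hx)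

theorem tendsto_integral_exp_neg_mul_mul (hf : AEStronglyMeasurable f μ)
    (hf0 : ∀ᵐ x ∂μ, 0 < f x) (hk : Integrable k μ) :
    Tendsto (fun c : ℝ => ∫ x, Real.exp (-(c * f x)) * k x ∂μ) atTop (𝓝 0) := by
  have hf0' : 0 ≤ᵐ[μ] f := hf0.mono fun _ hx => hx.le
  have hlim : ∀ᵐ x ∂μ, Tendsto (fun c : ℝ => Real.exp (-(c * f x)) * k x) atTop (𝓝 0) := by
    filter_upwards [hf0] with x hx
    simpa using (Real.tendsto_exp_neg_atTop_nhds_zero.comp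
      (tendsto_id.atTop_mul_const hx)).mul_const (k x)
  have hbound : ∀ᶠ c : ℝ in atTop, ∀ᵐ x ∂μ, ‖Real.exp (-(c * f x)) * k x‖ ≤ ‖k x‖ := by
    filter_upwards [eventually_ge_atTop 0] with c hc
    filter_upwards [hf0'] with x hx
    rw [norm_mul]
    exact mul_le_of_le_one_left (norm_nonneg _) (norm_exp_neg_mul_le_one hc hx)
  have hmeas : ∀ᶠ c : ℝ in atTop,
      AEStronglyMeasurable (fun x => Real.exp (-(c * f x)) * k x) μ := by
    filter_upwards [eventually_ge_atTop 0] with c hc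
    exact (integrable_exp_neg_mul_mul hc hf hf0' hk).aestronglyMeasurable
  simpa using tendsto_integral_filter_of_dominated_convergence _ hmeas hbound hk.norm hlim

theorem le_integral_exp_neg_mul_mul_sub {c A B : ℝ} {s : Set α} (hc : 0 ≤ c)
    (hf : AEStronglyMeasurable f μ) (hf0 : 0 ≤ᵐ[μ] f) (hk : Integrable k μ) (hk0 : 0 ≤ᵐ[μ] k)
    (hs : MeasurableSet s) (hfs : ∀ x ∈ s, f x ∈ Set.Icc A B) :
    Real.exp (-(c * B)) * (1 - Real.exp (-A)) * ∫ x in s, k x ∂μ ≤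
      ∫ x, Real.exp (-(c * f x)) * k x ∂μ - ∫ x, Real.exp (-((c + 1) * f x)) * k x ∂μ := by
  have hsplit (x : α) : Real.exp (-(c * f x)) * k x - Real.exp (-((c + 1) * f x)) * k x =
      Real.exp (-(c * f x)) * (1 - Real.exp (-f x)) * k x := by
    rw [add_mul, one_mul, neg_add, Real.exp_add]
    ring
  have hint := (integrable_exp_neg_mul_mul hc hf hf0 hk).sub
    (integrable_exp_neg_mul_mul (by positivity : 0 ≤ c + 1) hf hf0 hk)
  simp only [Pi.sub_def, hsplit] at hint
  rw [← integral_sub (integrable_exp_neg_mul_mul hc hf hf0 hk)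
    (integrable_exp_neg_mul_mul (by positivity) hf hf0 hk), ← integral_const_mul]
  simp only [hsplit]
  have hnonneg : 0 ≤ᵐ[μ] fun x => Real.exp (-(c * f x)) * (1 - Real.exp (-f x)) * k x := by
    filter_upwards [hf0, hk0] with x (hfx : 0 ≤ f x) (hkx : 0 ≤ k x)
    have : 0 ≤ 1 - Real.exp (-f x) := sub_nonneg.2 (Real.exp_le_one_iff.2 (neg_nonpos.2 hfx))
    exact mul_nonneg (mul_nonneg (Real.exp_nonneg _) this) hkx
  refine (integral_mono_ae (hk.integrableOn.const_mul _) hint.integrableOn ?_).trans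
    (setIntegral_le_integral hint hnonneg)
  filter_upwards [ae_restrict_of_ae hf0, ae_restrict_of_ae hk0, ae_restrict_mem hs] with
    x (hfx : 0 ≤ f x) (hkx : 0 ≤ k x) hx
  obtain ⟨hA, hB⟩ := hfs x hx
  have : 0 ≤ 1 - Real.exp (-f x) := sub_nonneg.2 (Real.exp_le_one_iff.2 (neg_nonpos.2 hfx))
  refine mul_le_mul_of_nonneg_right (mul_le_mul_of_nonneg ?_ ?_ (Real.exp_nonneg _) this) hkx
  all_goals gcongr

end LaplaceTransform

section RunningTime

variable {n : ℕ}

/-- The total number of operations counted in a configuration. -/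
def Config.cost (c : Config n) : ℕ := c.assignments + c.comparisons

theorem cost_clearLoop (l : List (Fin n)) (c : Config n) :
    (clearLoop l c).cost = c.cost + l.length := by
  induction l generalizing c with
  | nil => rfl
  | cons i l ih =>
    simp only [clearLoop, ih]
    simp only [Config.cost, Config.assignV, List.length_cons]
    omega

theorem clearLoop_v_eq_zero {l : List (Fin n)} {c : Config n} {k : Fin n}
    (h : k ∈ l ∨ c.v k = 0) : (clearLoop l c).v k = 0 := by
  induction l generalizing c with
  | nil => simpa [clearLoop] using h
  | cons i l ih =>
    refine ih ?_
    by_cases hk : k = i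
    · exact Or.inr (by simp [Config.assignV, hk])
    · simpa [Config.assignV, hk] using h

/-- The positions listed in `l` carry pairwise distinct values under `s`, none of which is marked
in `c`: this is when `testLoop s l` started in `c` completes without returning early. -/
def Passes (s : Fin n → Fin n) (c : Config n) (l : List (Fin n)) : Prop :=
  (l.map s).Nodup ∧ ∀ i ∈ l, c.v (s i) = 0

theorem passes_nil (s : Fin n → Fin n) (c : Config n) : Passes s c [] := by
  simp [Passes]

theorem passes_cons_iff {s : Fin n → Fin n} {c : Config n} {i : Fin n} {l : List (Fin n)} :
    Passes s c (i :: l) ↔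
      c.v (s i) = 0 ∧ Passes s (c.tickComparison.assignV (s i) (c.v (s i) + 1)) l := by
  have hmark (k : Fin n) : (c.tickComparison.assignV (s i) (c.v (s i) + 1)).v k = 0 ↔
      k ≠ s i ∧ c.v k = 0 := by
    by_cases hk : k = s i <;> simp [Config.assignV, Config.tickComparison, hk]
  simp only [Passes, hmark, List.map_cons, List.nodup_cons, List.mem_map, List.forall_mem_cons]
  grind

open Classical in
theorem cost_testLoop (s : Fin n → Fin n) (l : List (Fin n)) (c : Config n) :
    (testLoop s l c).cost =
      c.cost + 2 * ∑ j ∈ Finset.range l.length, if Passes s c (l.take j) then 1 else 0 := by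
  induction l generalizing c with
  | nil => simp [testLoop]
  | cons i l ih =>
    simp only [testLoop, List.length_cons, Finset.sum_range_succ', List.take_succ_cons,
      List.take_zero, passes_nil, passes_cons_iff, if_true]
    split_ifs with h
    · simp only [Config.cost, Config.assignG, Config.tickComparison, h.ne', false_and, if_false,
        Finset.sum_const_zero]
      omega
    · simp only [ih, Nat.eq_zero_of_not_pos h, true_and]
      simp only [Config.cost, Config.assignV, Config.tickComparison]
      omega

theorem passes_take_finRange_iff {s : Fin n → Fin n} {c : Config n} {j : ℕ} (hj : j ≤ n)
    (hc : ∀ k, c.v k = 0) :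
    Passes s c ((List.finRange n).take j) ↔ Function.Injective (Fin.take j hj s) := by
  rw [Passes, List.map_take, ← List.ofFn_eq_map, ← Fin.ofFn_take_eq_take_ofFn, List.nodup_ofFn]
  exact and_iff_left fun i _ => hc (s i)

open Classical in
theorem runningTime_eq (g₀ : Bool) (v₀ : Fin n → ℕ) (s : Fin n → Fin n) :
    runningTime g₀ v₀ s =
      n + 1 + 2 * ∑ j : Fin n, if Function.Injective (Fin.take j j.2.le s) then 1 else 0 := by
  change (run g₀ v₀ s).cost = _
  rw [run, cost_testLoop, cost_clearLoop, List.length_finRange, Finset.sum_range]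
  congr 1
  · simp only [Config.cost, Config.assignG]
    omega
  · congr! 3 with j
    exact passes_take_finRange_iff j.2.le fun k => clearLoop_v_eq_zero (.inl (List.mem_finRange k))

end RunningTime

section Probability

variable {n : ℕ} {Ω : Type*} [MeasurableSpace Ω] {P : Measure Ω}

/-- The probability that `k` independent uniformly distributed elements of an `n`-element set are
pairwise distinct. -/
noncomputable def distinctProb (n k : ℕ) : ℝ := n.descFactorial k / (n : ℝ) ^ k

theorem card_filter_injective (ι α : Type*) [Fintype ι] [Fintype α] [DecidableEq ι]
    [DecidablePred (Function.Injective : (ι → α) → Prop)] :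
    (Finset.univ.filter (Function.Injective : (ι → α) → Prop)).card =
      (Fintype.card α).descFactorial (Fintype.card ι) := by
  classical
  rw [← Fintype.card_subtype, Fintype.card_congr (Equiv.subtypeInjectiveEquivEmbedding _ _),
    Fintype.card_embedding_eq]

theorem measureReal_injective {ι α : Type*} [Fintype ι] [Fintype α] [MeasurableSpace α]
    [MeasurableSingletonClass α] {x : ι → Ω → α} (hx : ∀ i, AEMeasurable (x i) P)
    (hind : iIndepFun x P) (hunif : ∀ i a, P.real {ω | x i ω = a} = 1 / (Fintype.card α : ℝ)) :
    P.real {ω | Function.Injective fun i => x i ω} =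
      distinctProb (Fintype.card α) (Fintype.card ι) := by
  classical
  have := hind.isProbabilityMeasure
  have hpoint (t : ι → α) : (P.map fun ω i => x i ω).real {t} =
      (1 / (Fintype.card α : ℝ)) ^ Fintype.card ι := by
    have hmarginal (i : ι) : (P.map (x i)).real {t i} = 1 / (Fintype.card α : ℝ) :=
      (map_measureReal_apply_of_aemeasurable (hx i) (measurableSet_singleton _)).trans (hunif i _)
    rw [hind.map_fun_eq_pi_map hx, measureReal_def, Measure.pi_singleton, ENNReal.toReal_prod]
    simp only [← measureReal_def, hmarginal, Finset.prod_const, Finset.card_univ]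
  have hmeas : AEMeasurable (fun ω i => x i ω) P := aemeasurable_pi_lambda _ hx
  have hset : {t : ι → α | Function.Injective t} =
      ↑(Finset.univ.filter (Function.Injective : (ι → α) → Prop)) := by simp
  calc P.real {ω | Function.Injective fun i => x i ω}
      = (P.map fun ω i => x i ω).real {t | Function.Injective t} :=
        (map_measureReal_apply_of_aemeasurable (s := {t : ι → α | Function.Injective t}) hmeas
          (Set.toFinite _).measurableSet).symm
    _ = distinctProb (Fintype.card α) (Fintype.card ι) := by
        have := Measure.isProbabilityMeasure_map hmeas
        rw [hset, ← sum_measureReal_singleton, Finset.sum_congr rfl fun t _ => hpoint t,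
          Finset.sum_const, card_filter_injective, distinctProb, nsmul_eq_mul, one_div, inv_pow,
          div_eq_mul_inv]

/-- The expected number of comparisons of `Linear`: its `(j + 1)`-st comparison takes place when
the first `j` elements of the input are pairwise distinct. -/
noncomputable def expectedComparisons (n : ℕ) : ℝ := ∑ j ∈ Finset.range n, distinctProb n j

theorem integral_runningTime {x : Fin n → Ω → Fin n} (hx : ∀ i, Measurable (x i))
    (hind : iIndepFun x P) (hunif : ∀ i k, P.real {ω | x i ω = k} = 1 / (n : ℝ))
    (g₀ : Bool) (v₀ : Fin n → ℕ) :
    ∫ ω, (runningTime g₀ v₀ (fun i => x i ω) : ℝ) ∂P = n + 1 + 2 * expectedComparisons n := by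
  classical
  have := hind.isProbabilityMeasure
  let distinct (j : Fin n) : Set Ω :=
    {ω | Function.Injective fun i : Fin j => x (Fin.castLE j.2.le i) ω}
  have hmeas (j : Fin n) : MeasurableSet (distinct j) :=
    measurable_pi_lambda (fun ω (i : Fin j) => x (Fin.castLE j.2.le i) ω) (fun i => hx _)
      (Set.toFinite {t | Function.Injective t}).measurableSet
  have hint (j : Fin n) : Integrable ((distinct j).indicator (1 : Ω → ℝ)) P :=
    (integrable_const 1).indicator (hmeas j)
  have hprob (j : Fin n) : P.real (distinct j) = distinctProb n j := by
    simpa using measureReal_injective (x := fun i : Fin j => x (Fin.castLE j.2.le i))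
      (fun i => (hx _).aemeasurable) (hind.precomp (Fin.castLE_injective j.2.le))
      (by simpa using fun i => hunif _)
  calc ∫ ω, (runningTime g₀ v₀ (fun i => x i ω) : ℝ) ∂P
      = ∫ ω, ((n + 1 : ℝ) + 2 * ∑ j, (distinct j).indicator 1 ω) ∂P := by
        refine integral_congr_ae (.of_forall fun ω => ?_)
        simp only [runningTime_eq, Set.indicator_apply]
        push_cast
        rfl
    _ = n + 1 + 2 * ∑ j : Fin n, distinctProb n j := by
        rw [integral_add (integrable_const _)
            ((integrable_finsetSum _ fun j _ => hint j).const_mul 2),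
          integral_const_mul, integral_finsetSum _ fun j _ => hint j]
        simp [integral_indicator_one (hmeas _), hprob]
    _ = n + 1 + 2 * expectedComparisons n := by
        rw [expectedComparisons, Finset.sum_range]

end Probability

section KappaAsSum

variable {n : ℕ}

theorem distinctProb_self (n : ℕ) : distinctProb n n = (n ! : ℝ) / (n : ℝ) ^ n := by
  rw [distinctProb, Nat.descFactorial_self]

theorem distinctProb_succ (hn : n ≠ 0) (k : ℕ) :
    distinctProb n (k + 1) = distinctProb n k * (1 - k / n) := by
  rcases le_or_gt k n with hk | hk
  · rw [distinctProb, distinctProb, Nat.descFactorial_succ, Nat.cast_mul, Nat.cast_sub hk]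
    field_simp
    ring
  · simp [distinctProb, Nat.descFactorial_of_lt, hk]

theorem sum_sq_mul_distinctProb (hn : n ≠ 0) (m : ℕ) :
    ∑ k ∈ Finset.Icc 1 m, (k : ℝ) ^ 2 * distinctProb n k / n =
      ∑ k ∈ Finset.range (m + 1), distinctProb n k - 1 - m * distinctProb n (m + 1) := by
  induction m with
  | zero => simp [distinctProb]
  | succ m ih =>
    rw [Finset.sum_Icc_succ_top (by omega), ih, Finset.sum_range_succ _ (m + 1),
      distinctProb_succ hn (m + 1)]
    push_cast
    ring

theorem kappa_eq (hn : n ≠ 0) :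
    kappa n = ∑ k ∈ Finset.range (n + 1), distinctProb n k - 2 / 3 - √(Real.pi * n / 2) := by
  have hterm (k : ℕ) (hk : k ∈ Finset.Icc 1 n) :
      ((n ! : ℝ) * (k : ℝ) ^ 2) / (((n - k)! : ℝ) * (n : ℝ) ^ (k + 1)) =
        (k : ℝ) ^ 2 * distinctProb n k / n := by
    rw [distinctProb, ← Nat.factorial_mul_descFactorial (Finset.mem_Icc.1 hk).2]
    push_cast
    field_simp
    ring
  have hlast : distinctProb n (n + 1) = 0 := by simp [distinctProb]
  rw [kappa, Finset.sum_congr rfl hterm, sum_sq_mul_distinctProb hn, hlast]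
  ring

theorem delta_eq (hn : n ≠ 0) :
    delta n = expectedComparisons n - 2 / 3 - √(Real.pi * n / 2) := by
  rw [delta, kappa_eq hn, Finset.sum_range_succ, distinctProb_self, expectedComparisons]
  ring

end KappaAsSum

section LogGap

/-- The exponent `y - log (1 + y)` of the Laplace integrals below: it arises from
`(1 + y) ^ n * exp (-n * y) = exp (-n * (y - log (1 + y)))`. -/
noncomputable def logGap (y : ℝ) : ℝ := y - Real.log (1 + y)

theorem logGap_zero : logGap 0 = 0 := by simp [logGap]

theorem hasDerivAt_logGap {y : ℝ} (hy : -1 < y) : HasDerivAt logGap (y / (1 + y)) y := by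
  have h : 1 + y ≠ 0 := by linarith
  refine ((hasDerivAt_id y).sub (((hasDerivAt_id y).const_add 1).log h)).congr_deriv ?_
  simp only [id]
  field_simp
  ring

theorem continuousOn_logGap : ContinuousOn logGap (Set.Ici 0) := fun _ hy =>
  (hasDerivAt_logGap (neg_one_lt_zero.trans_le hy)).continuousAt.continuousWithinAt

theorem logGap_strictMonoOn : StrictMonoOn logGap (Set.Ici 0) := by
  refine strictMonoOn_of_deriv_pos (convex_Ici 0) continuousOn_logGap fun y hy => ?_
  have hy : 0 < y := by simpa using hy
  rw [(hasDerivAt_logGap (by linarith)).deriv]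
  positivity

theorem logGap_pos {y : ℝ} (hy : 0 < y) : 0 < logGap y := by
  simpa only [logGap_zero] using logGap_strictMonoOn Set.self_mem_Ici hy.le hy

theorem logGap_nonneg {y : ℝ} (hy : 0 ≤ y) : 0 ≤ logGap y := by
  simpa only [logGap_zero] using logGap_strictMonoOn.monotoneOn Set.self_mem_Ici hy hy

theorem tendsto_logGap_atTop : Tendsto logGap atTop atTop := by
  have hlinear : Tendsto (fun y : ℝ => y / 2 - Real.log 2 + 1 / 2) atTop atTop :=
    tendsto_atTop_add_const_right _ _
      (tendsto_atTop_add_const_right _ _ (tendsto_id.atTop_div_const two_pos))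
  refine tendsto_atTop_mono' _ ?_ hlinear
  filter_upwards [eventually_ge_atTop 0] with y hy
  have hlog := Real.log_le_sub_one_of_pos (x := (1 + y) / 2) (by positivity)
  rw [Real.log_div (by positivity) two_ne_zero] at hlog
  rw [logGap]
  linarith

theorem logGap_le {y : ℝ} (hy : 0 ≤ y) : logGap y ≤ y ^ 2 / 2 - y ^ 3 / 3 + y ^ 4 / 4 := by
  refine le_of_hasDerivAt_le (f' := fun y => y / (1 + y)) (f := logGap)
    (g := fun y => y ^ 2 / 2 - y ^ 3 / 3 + y ^ 4 / 4) (g' := fun y => y - y ^ 2 + y ^ 3) hy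
    (by simp [logGap_zero]) (fun y hy => hasDerivAt_logGap (by linarith)) (fun y _ => ?_)
    (fun y hy => ?_)
  · refine ((((hasDerivAt_pow 2 y).div_const 2).sub ((hasDerivAt_pow 3 y).div_const 3)).add
      ((hasDerivAt_pow 4 y).div_const 4)).congr_deriv ?_
    norm_num
  · rw [div_le_iff₀ (by linarith)]
    nlinarith [pow_nonneg hy 4]

theorem le_logGap {y : ℝ} (hy : 0 ≤ y) : y ^ 2 / 2 - y ^ 3 / 3 ≤ logGap y := by
  refine le_of_hasDerivAt_le (g' := fun y => y / (1 + y)) (g := logGap)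
    (f := fun y => y ^ 2 / 2 - y ^ 3 / 3) (f' := fun y => y - y ^ 2) hy
    (by simp [logGap_zero]) (fun y _ => ?_) (fun y hy => hasDerivAt_logGap (by linarith))
    (fun y hy => ?_)
  · refine (((hasDerivAt_pow 2 y).div_const 2).sub ((hasDerivAt_pow 3 y).div_const 3)).congr_deriv
      ?_
    norm_num
  · rw [le_div_iff₀ (by linarith)]
    nlinarith [pow_nonneg hy 3]

-- Comparing derivatives reduces this to Bernoulli's inequality `(1 + y) ^ (2/3) ≤ 1 + 2/3 * y`.
theorem logGap_le_mul_rpow {y : ℝ} (hy : 0 ≤ y) :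
    logGap y ≤ y ^ 2 / 2 * (1 + y) ^ (-(2 / 3) : ℝ) := by
  refine le_of_hasDerivAt_le (f := logGap) (f' := fun y => y / (1 + y))
    (g := fun y => y ^ 2 / 2 * (1 + y) ^ (-(2 / 3) : ℝ))
    (g' := fun y => y * (1 + 2 / 3 * y) * (1 + y) ^ (-(5 / 3) : ℝ)) hy
    (by simp [logGap_zero]) (fun y hy => hasDerivAt_logGap (by linarith)) (fun y hy => ?_)
    (fun y hy => ?_)
  · have hpos : 0 < 1 + y := by linarith
    have hpow : (1 + y) ^ (-(2 / 3) : ℝ) = (1 + y) * (1 + y) ^ (-(5 / 3) : ℝ) := by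
      rw [← Real.rpow_one_add' hpos.le (by norm_num)]
      norm_num
    have hfactor : HasDerivAt (fun y : ℝ => (1 + y) ^ (-(2 / 3) : ℝ)) _ y :=
      ((hasDerivAt_id y).const_add 1).rpow_const (.inl hpos.ne')
    refine (((hasDerivAt_pow 2 y).div_const 2).mul hfactor).congr_deriv ?_
    norm_num [hpow]
    ring
  · have hpos : 0 < 1 + y := by linarith
    have hbernoulli : (1 + y) ^ (2 / 3 : ℝ) ≤ 1 + 2 / 3 * y :=
      rpow_one_add_le_one_add_mul_self (by linarith) (by norm_num) (by norm_num)
    calc y / (1 + y) = y * (1 + y) ^ (2 / 3 : ℝ) * (1 + y) ^ (-(5 / 3) : ℝ) := by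
          rw [mul_assoc, ← Real.rpow_add hpos, div_eq_mul_inv, ← Real.rpow_neg_one]
          norm_num
      _ ≤ y * (1 + 2 / 3 * y) * (1 + y) ^ (-(5 / 3) : ℝ) := by gcongr

end LogGap

section GaussCoord

/-- The coordinate `u ≥ 0` in which `exp (-c * logGap y)` is the Gaussian `exp (-c * u ^ 2 / 2)`. -/
noncomputable def gaussCoord (y : ℝ) : ℝ := √(2 * logGap y)

theorem gaussCoord_zero : gaussCoord 0 = 0 := by simp [gaussCoord, logGap_zero]

theorem gaussCoord_pos {y : ℝ} (hy : 0 < y) : 0 < gaussCoord y :=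
  Real.sqrt_pos.2 (mul_pos two_pos (logGap_pos hy))

theorem gaussCoord_sq {y : ℝ} (hy : 0 ≤ y) : gaussCoord y ^ 2 = 2 * logGap y :=
  Real.sq_sqrt (mul_nonneg zero_le_two (logGap_nonneg hy))

theorem tendsto_gaussCoord_atTop : Tendsto gaussCoord atTop atTop :=
  Real.tendsto_sqrt_atTop.comp (tendsto_logGap_atTop.const_mul_atTop two_pos)

theorem continuousOn_gaussCoord : ContinuousOn gaussCoord (Set.Ici 0) :=
  (continuousOn_logGap.const_mul 2).sqrt

theorem gaussCoord_strictMonoOn : StrictMonoOn gaussCoord (Set.Ici 0) := fun _ hx _ hy hxy =>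
  Real.sqrt_lt_sqrt (mul_nonneg zero_le_two (logGap_nonneg hx))
    (mul_lt_mul_of_pos_left (logGap_strictMonoOn hx hy hxy) two_pos)

theorem hasDerivAt_gaussCoord {y : ℝ} (hy : 0 < y) :
    HasDerivAt gaussCoord (y / ((1 + y) * gaussCoord y)) y := by
  refine (((hasDerivAt_logGap (by linarith)).const_mul 2).sqrt
    (mul_pos two_pos (logGap_pos hy)).ne').congr_deriv ?_
  have := gaussCoord_pos hy
  rw [← gaussCoord]
  field_simp

theorem gaussCoord_pow_three_mul_le {y : ℝ} (hy : 0 ≤ y) :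
    gaussCoord y ^ 3 * (1 + y) ≤ y ^ 3 := by
  have hsq : gaussCoord y ^ 2 ≤ y ^ 2 * (1 + y) ^ (-(2 / 3) : ℝ) := by
    rw [gaussCoord_sq hy]
    linarith [logGap_le_mul_rpow hy]
  have hcube : ((1 + y) ^ (-(2 / 3) : ℝ)) ^ 3 * (1 + y) ^ 2 = 1 := by
    rw [← Real.rpow_mul_natCast (by positivity), ← Real.rpow_add_natCast (by positivity)]
    norm_num
  refine le_of_sq_le_sq ?_ (by positivity)
  calc (gaussCoord y ^ 3 * (1 + y)) ^ 2 = (gaussCoord y ^ 2) ^ 3 * (1 + y) ^ 2 := by ring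
    _ ≤ (y ^ 2 * (1 + y) ^ (-(2 / 3) : ℝ)) ^ 3 * (1 + y) ^ 2 := by gcongr
    _ = (y ^ 3) ^ 2 * (((1 + y) ^ (-(2 / 3) : ℝ)) ^ 3 * (1 + y) ^ 2) := by ring
    _ = (y ^ 3) ^ 2 := by rw [hcube, mul_one]

end GaussCoord

section GapKernel

/-- The function whose derivative `gapKernel` has `kappa` as its Laplace transform in the variable
`logGap`. At the origin it has the limit `-1 / 3`, not its junk value `0`. -/
noncomputable def gapPrimitive (y : ℝ) : ℝ := 1 / y - 1 / gaussCoord y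

/-- The derivative of `gapPrimitive`, a nonnegative integrable density on the positive half-line. -/
noncomputable def gapKernel (y : ℝ) : ℝ := y / ((1 + y) * gaussCoord y ^ 3) - 1 / y ^ 2

theorem gapKernel_nonneg {y : ℝ} (hy : 0 < y) : 0 ≤ gapKernel y := by
  have := gaussCoord_pos hy
  rw [gapKernel, sub_nonneg, div_le_div_iff₀ (by positivity) (by positivity)]
  linarith [gaussCoord_pow_three_mul_le hy.le]

theorem hasDerivAt_gapPrimitive {y : ℝ} (hy : 0 < y) :
    HasDerivAt gapPrimitive (gapKernel y) y := by
  have hu := gaussCoord_pos hy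
  simp only [funext fun z => show gapPrimitive z = z⁻¹ - (gaussCoord z)⁻¹ by simp [gapPrimitive]]
  refine ((hasDerivAt_inv hy.ne').sub ((hasDerivAt_gaussCoord hy).inv hu.ne')).congr_deriv ?_
  rw [gapKernel]
  field_simp
  ring

theorem tendsto_gaussCoord_sq_sub_sq_div :
    Tendsto (fun y => (gaussCoord y ^ 2 - y ^ 2) / y ^ 3) (𝓝[>] 0) (𝓝 (-2 / 3)) := by
  have hupper : Tendsto (fun y : ℝ => -2 / 3 + y / 2) (𝓝[>] 0) (𝓝 (-2 / 3)) := by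
    have : Continuous fun y : ℝ => -2 / 3 + y / 2 := by fun_prop
    simpa using (this.tendsto 0).mono_left nhdsWithin_le_nhds
  refine tendsto_of_tendsto_of_tendsto_of_le_of_le' tendsto_const_nhds hupper ?_ ?_
  · filter_upwards [self_mem_nhdsWithin] with y (hy : 0 < y)
    rw [gaussCoord_sq hy.le, le_div_iff₀ (by positivity)]
    linarith [le_logGap hy.le]
  · filter_upwards [self_mem_nhdsWithin] with y (hy : 0 < y)
    rw [gaussCoord_sq hy.le, div_le_iff₀ (by positivity)]
    linarith [logGap_le hy.le]

theorem tendsto_gaussCoord_div_self :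
    Tendsto (fun y => gaussCoord y / y) (𝓝[>] 0) (𝓝 1) := by
  have hid : Tendsto (fun y : ℝ => y) (𝓝[>] 0) (𝓝 0) := tendsto_id.mono_left nhdsWithin_le_nhds
  have hsqrt := ((hid.mul tendsto_gaussCoord_sq_sub_sq_div).const_add 1).sqrt
  rw [zero_mul, add_zero, Real.sqrt_one] at hsqrt
  refine hsqrt.congr' ?_
  filter_upwards [self_mem_nhdsWithin] with y (hy : 0 < y)
  have hu := gaussCoord_pos hy
  rw [Real.sqrt_eq_iff_eq_sq (by field_simp; linarith [sq_nonneg (gaussCoord y)]) (by positivity)]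
  field_simp
  ring

theorem tendsto_gapPrimitive_zero : Tendsto gapPrimitive (𝓝[>] 0) (𝓝 (-1 / 3)) := by
  have hquot := tendsto_gaussCoord_div_self
  have hlim := tendsto_gaussCoord_sq_sub_sq_div.div (hquot.mul (hquot.add_const 1)) (by norm_num)
  rw [show (-2 / 3 / (1 * (1 + 1)) : ℝ) = -1 / 3 by norm_num] at hlim
  refine hlim.congr' ?_
  filter_upwards [self_mem_nhdsWithin] with y (hy : 0 < y)
  have hu := gaussCoord_pos hy
  simp only [Pi.div_apply, gapPrimitive]
  field_simp
  ring

theorem tendsto_gapPrimitive_atTop : Tendsto gapPrimitive atTop (𝓝 0) := by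
  have h := tendsto_inv_atTop_zero.sub (tendsto_inv_atTop_zero.comp tendsto_gaussCoord_atTop)
  rw [sub_zero] at h
  exact h.congr fun y => by simp only [gapPrimitive, one_div, Function.comp_apply]

theorem integrableOn_gapKernel : IntegrableOn gapKernel (Set.Ioi 0) :=
  integrableOn_Ioi_deriv_of_nonneg_of_tendsto (fun _ hy => hasDerivAt_gapPrimitive hy)
    (fun _ hy => gapKernel_nonneg hy) tendsto_gapPrimitive_zero tendsto_gapPrimitive_atTop

theorem integral_Ioc_gapKernel {a b : ℝ} (ha : 0 < a) (hab : a ≤ b) :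
    ∫ y in Set.Ioc a b, gapKernel y = gapPrimitive b - gapPrimitive a := by
  have hint : IntegrableOn gapKernel (Set.Ioc a b) :=
    integrableOn_gapKernel.mono_set fun _ hy => ha.trans hy.1
  rw [← intervalIntegral.integral_of_le hab]
  refine intervalIntegral.integral_eq_sub_of_hasDerivAt (fun y hy => ?_)
    ((intervalIntegrable_iff_integrableOn_Ioc_of_le hab).2 hint)
  rw [Set.uIcc_of_le hab] at hy
  exact hasDerivAt_gapPrimitive (ha.trans_le hy.1)

end GapKernel

section LaplaceIntegrals

theorem integrableOn_pow_mul_exp_neg_mul (k : ℕ) {c : ℝ} (hc : 0 < c) :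
    IntegrableOn (fun y : ℝ => y ^ k * Real.exp (-(c * y))) (Set.Ioi 0) := by
  have hk : (-1 : ℝ) < k := neg_one_lt_zero.trans_le k.cast_nonneg
  simpa using integrableOn_rpow_mul_exp_neg_mul_rpow hk one_pos hc

theorem integral_pow_mul_exp_neg_mul (k : ℕ) {c : ℝ} (hc : 0 < c) :
    ∫ y in Set.Ioi (0 : ℝ), y ^ k * Real.exp (-(c * y)) = (k ! : ℝ) / c ^ (k + 1) := by
  have h := Real.integral_rpow_mul_exp_neg_mul_Ioi (a := ((k + 1 : ℕ) : ℝ)) (by positivity) hc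
  rw [Real.rpow_natCast, one_div_pow, one_div_mul_eq_div, Nat.cast_succ,
    Real.Gamma_nat_eq_factorial] at h
  simpa using h

theorem exp_neg_natCast_mul_logGap (n : ℕ) {y : ℝ} (hy : -1 < y) :
    Real.exp (-(n * logGap y)) =
      ∑ k ∈ Finset.range (n + 1), (n.choose k : ℝ) * (y ^ k * Real.exp (-(n * y))) := by
  have hpos : 0 < 1 + y := by linarith
  calc Real.exp (-(n * logGap y))
      = Real.exp (n * Real.log (1 + y)) * Real.exp (-(n * y)) := by
        rw [← Real.exp_add, logGap]
        ring_nf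
    _ = (y + 1) ^ n * Real.exp (-(n * y)) := by
        rw [Real.exp_nat_mul, Real.exp_log hpos, add_comm]
    _ = ∑ k ∈ Finset.range (n + 1), (n.choose k : ℝ) * (y ^ k * Real.exp (-(n * y))) := by
        rw [add_pow, Finset.sum_mul]
        refine Finset.sum_congr rfl fun k _ => ?_
        rw [one_pow]
        ring

theorem integrableOn_exp_neg_natCast_mul_logGap {n : ℕ} (hn : n ≠ 0) :
    IntegrableOn (fun y => Real.exp (-(n * logGap y))) (Set.Ioi 0) := by
  have hn' : (0 : ℝ) < n := by positivity
  have hsum : IntegrableOn (fun y => ∑ k ∈ Finset.range (n + 1),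
      (n.choose k : ℝ) * (y ^ k * Real.exp (-(n * y)))) (Set.Ioi 0) :=
    integrable_finsetSum _ fun k _ => (integrableOn_pow_mul_exp_neg_mul k hn').const_mul _
  exact hsum.congr_fun
    (fun y hy => (exp_neg_natCast_mul_logGap n (neg_one_lt_zero.trans hy)).symm) measurableSet_Ioi

theorem mul_integral_exp_neg_natCast_mul_logGap {n : ℕ} (hn : n ≠ 0) :
    n * ∫ y in Set.Ioi (0 : ℝ), Real.exp (-(n * logGap y)) =
      ∑ k ∈ Finset.range (n + 1), distinctProb n k := by
  have hn' : (0 : ℝ) < n := by positivity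
  rw [setIntegral_congr_fun measurableSet_Ioi
      (fun y hy => exp_neg_natCast_mul_logGap n (neg_one_lt_zero.trans hy)),
    integral_finsetSum _ fun k _ => (integrableOn_pow_mul_exp_neg_mul k hn').const_mul _,
    Finset.mul_sum]
  refine Finset.sum_congr rfl fun k _ => ?_
  rw [integral_const_mul, integral_pow_mul_exp_neg_mul k hn', distinctProb,
    Nat.descFactorial_eq_factorial_mul_choose]
  push_cast
  field_simp
  ring

variable {c : ℝ}

theorem integrableOn_div_mul_exp_neg_mul_logGap (hc : 0 < c) :
    IntegrableOn (fun y => y / (1 + y) * Real.exp (-(c * logGap y))) (Set.Ioi 0) := by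
  refine integrableOn_Ioi_deriv_mul_comp (g := fun t => Real.exp (-(c * t))) logGap_strictMonoOn
    continuousOn_logGap (fun y hy => hasDerivAt_logGap (neg_one_lt_zero.trans hy))
    tendsto_logGap_atTop ?_
  simpa only [neg_mul] using integrableOn_exp_mul_Ioi (neg_lt_zero.2 hc) (logGap 0)

theorem mul_integral_div_mul_exp_neg_mul_logGap (hc : 0 < c) :
    c * ∫ y in Set.Ioi (0 : ℝ), y / (1 + y) * Real.exp (-(c * logGap y)) = 1 := by
  rw [integral_Ioi_deriv_mul_comp (g := fun t => Real.exp (-(c * t))) logGap_strictMonoOn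
    continuousOn_logGap (fun y hy => hasDerivAt_logGap (neg_one_lt_zero.trans hy))
    tendsto_logGap_atTop, logGap_zero]
  simp only [← neg_mul]
  rw [integral_exp_mul_Ioi (neg_lt_zero.2 hc)]
  simp [hc.ne']

theorem exp_neg_half_mul_gaussCoord_sq {y : ℝ} (hy : 0 ≤ y) :
    Real.exp (-(c / 2) * gaussCoord y ^ 2) = Real.exp (-(c * logGap y)) := by
  rw [gaussCoord_sq hy]
  ring_nf

theorem integrableOn_div_gaussCoord_mul_exp_neg_mul_logGap (hc : 0 < c) :
    IntegrableOn (fun y => y / ((1 + y) * gaussCoord y) * Real.exp (-(c * logGap y)))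
      (Set.Ioi 0) := by
  have hsubst : IntegrableOn
      (fun y => y / ((1 + y) * gaussCoord y) * Real.exp (-(c / 2) * gaussCoord y ^ 2))
      (Set.Ioi 0) :=
    integrableOn_Ioi_deriv_mul_comp (g := fun u => Real.exp (-(c / 2) * u ^ 2))
      gaussCoord_strictMonoOn continuousOn_gaussCoord (fun y hy => hasDerivAt_gaussCoord hy)
      tendsto_gaussCoord_atTop (integrable_exp_neg_mul_sq (half_pos hc)).integrableOn
  refine hsubst.congr_fun (fun y (hy : 0 < y) => ?_) measurableSet_Ioi
  simp only [exp_neg_half_mul_gaussCoord_sq hy.le]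

theorem mul_integral_div_gaussCoord_mul_exp_neg_mul_logGap (hc : 0 < c) :
    c * ∫ y in Set.Ioi (0 : ℝ), y / ((1 + y) * gaussCoord y) * Real.exp (-(c * logGap y)) =
      √(Real.pi * c / 2) := by
  have hsubst :=
    calc ∫ y in Set.Ioi (0 : ℝ), y / ((1 + y) * gaussCoord y) * Real.exp (-(c * logGap y))
      _ = ∫ y in Set.Ioi (0 : ℝ),
            y / ((1 + y) * gaussCoord y) * Real.exp (-(c / 2) * gaussCoord y ^ 2) := by
          refine setIntegral_congr_fun measurableSet_Ioi fun y (hy : 0 < y) => ?_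
          simp only [exp_neg_half_mul_gaussCoord_sq hy.le]
      _ = ∫ u in Set.Ioi (gaussCoord 0), Real.exp (-(c / 2) * u ^ 2) :=
          integral_Ioi_deriv_mul_comp (g := fun u => Real.exp (-(c / 2) * u ^ 2))
            gaussCoord_strictMonoOn continuousOn_gaussCoord (fun y hy => hasDerivAt_gaussCoord hy)
            tendsto_gaussCoord_atTop
      _ = √(Real.pi / (c / 2)) / 2 := by rw [gaussCoord_zero, integral_gaussian_Ioi]
  have hscale : Real.pi * c / 2 = (c / 2) ^ 2 * (Real.pi / (c / 2)) := by
    field_simp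
  rw [hsubst, hscale, Real.sqrt_mul (by positivity), Real.sqrt_sq (by positivity)]
  ring

theorem hasDerivAt_exp_neg_mul_logGap (c : ℝ) {y : ℝ} (hy : -1 < y) :
    HasDerivAt (fun y => Real.exp (-(c * logGap y)))
      (-(c * (y / (1 + y) * Real.exp (-(c * logGap y))))) y := by
  refine ((hasDerivAt_logGap hy).const_mul c).fun_neg.exp.congr_deriv ?_
  ring

theorem tendsto_exp_neg_mul_logGap_atTop (hc : 0 < c) :
    Tendsto (fun y => Real.exp (-(c * logGap y))) atTop (𝓝 0) :=
  Real.tendsto_exp_neg_atTop_nhds_zero.comp (tendsto_logGap_atTop.const_mul_atTop hc)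

theorem aestronglyMeasurable_logGap :
    AEStronglyMeasurable logGap (volume.restrict (Set.Ioi 0)) :=
  (continuousOn_logGap.mono Set.Ioi_subset_Ici_self).aestronglyMeasurable measurableSet_Ioi

theorem ae_logGap_pos : ∀ᵐ y ∂volume.restrict (Set.Ioi (0 : ℝ)), 0 < logGap y :=
  (ae_restrict_mem measurableSet_Ioi).mono fun _ hy => logGap_pos hy

theorem ae_logGap_nonneg : 0 ≤ᵐ[volume.restrict (Set.Ioi (0 : ℝ))] logGap :=
  ae_logGap_pos.mono fun _ hy => hy.le

theorem integrableOn_exp_neg_mul_logGap_mul_gapKernel (hc : 0 ≤ c) :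
    IntegrableOn (fun y => Real.exp (-(c * logGap y)) * gapKernel y) (Set.Ioi 0) :=
  integrable_exp_neg_mul_mul hc aestronglyMeasurable_logGap ae_logGap_nonneg integrableOn_gapKernel

theorem neg_mul_exp_neg_mul_logGap_mul_gapPrimitive (c : ℝ) {y : ℝ} (hy : 0 < y) :
    -(c * (y / (1 + y) * Real.exp (-(c * logGap y)))) * gapPrimitive y =
      c * (y / ((1 + y) * gaussCoord y) * Real.exp (-(c * logGap y))) +
        c * (y / (1 + y) * Real.exp (-(c * logGap y))) - c * Real.exp (-(c * logGap y)) := by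
  have := gaussCoord_pos hy
  rw [gapPrimitive]
  field_simp
  ring

theorem tendsto_exp_neg_mul_logGap_mul_gapPrimitive_zero (c : ℝ) :
    Tendsto (fun y => Real.exp (-(c * logGap y)) * gapPrimitive y) (𝓝[>] 0) (𝓝 (-1 / 3)) := by
  have h := (hasDerivAt_exp_neg_mul_logGap c neg_one_lt_zero).continuousAt.tendsto
  simpa [logGap_zero] using (h.mono_left nhdsWithin_le_nhds).mul tendsto_gapPrimitive_zero

theorem kappa_eq_integral {n : ℕ} (hn : n ≠ 0) :
    kappa n = ∫ y in Set.Ioi (0 : ℝ), Real.exp (-(n * logGap y)) * gapKernel y := by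
  have hn' : (0 : ℝ) < n := by positivity
  have hplain := (integrableOn_exp_neg_natCast_mul_logGap hn).const_mul (n : ℝ)
  have hgap := (integrableOn_div_mul_exp_neg_mul_logGap hn').const_mul (n : ℝ)
  have hgauss := (integrableOn_div_gaussCoord_mul_exp_neg_mul_logGap hn').const_mul (n : ℝ)
  have hboundary : IntegrableOn
      (fun y => -(n * (y / (1 + y) * Real.exp (-(n * logGap y)))) * gapPrimitive y) (Set.Ioi 0) :=
    IntegrableOn.congr_fun ((hgauss.add hgap).sub hplain)
      (fun y hy => (neg_mul_exp_neg_mul_logGap_mul_gapPrimitive n hy).symm) measurableSet_Ioi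
  rw [integral_Ioi_mul_deriv_eq_deriv_mul
      (fun y hy => hasDerivAt_exp_neg_mul_logGap n (neg_one_lt_zero.trans hy))
      (fun y hy => hasDerivAt_gapPrimitive hy)
      (integrableOn_exp_neg_mul_logGap_mul_gapKernel n.cast_nonneg) hboundary
      (tendsto_exp_neg_mul_logGap_mul_gapPrimitive_zero n)
      ((tendsto_exp_neg_mul_logGap_atTop hn').mul tendsto_gapPrimitive_atTop),
    setIntegral_congr_fun measurableSet_Ioi
      (fun y hy => neg_mul_exp_neg_mul_logGap_mul_gapPrimitive n hy),
    integral_sub, integral_add hgauss hgap, integral_const_mul, integral_const_mul,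
    integral_const_mul, mul_integral_div_gaussCoord_mul_exp_neg_mul_logGap hn',
    mul_integral_div_mul_exp_neg_mul_logGap hn', mul_integral_exp_neg_natCast_mul_logGap hn,
    kappa_eq hn]
  · ring
  · exact hgauss.add hgap
  · exact hplain

theorem tendsto_kappa : Tendsto kappa atTop (𝓝 0) := by
  have h := (tendsto_integral_exp_neg_mul_mul aestronglyMeasurable_logGap ae_logGap_pos
    integrableOn_gapKernel).comp tendsto_natCast_atTop_atTop
  refine h.congr' ?_
  filter_upwards [eventually_ne_atTop 0] with n hn
  exact (kappa_eq_integral hn).symm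

theorem tendsto_delta : Tendsto delta atTop (𝓝 0) := by
  have h := tendsto_kappa.sub tendsto_factorial_div_pow_self_atTop
  rwa [sub_zero] at h

theorem le_kappa_sub_kappa_succ {n : ℕ} (hn : n ≠ 0) {a b : ℝ} (ha : 0 < a) (hab : a ≤ b) :
    Real.exp (-(n * logGap b)) * (1 - Real.exp (-logGap a)) * (gapPrimitive b - gapPrimitive a) ≤
      kappa n - kappa (n + 1) := by
  have hgap : ∀ y ∈ Set.Ioc a b, logGap y ∈ Set.Icc (logGap a) (logGap b) := fun y hy =>
    have hy0 : 0 ≤ y := ha.le.trans hy.1.le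
    ⟨logGap_strictMonoOn.monotoneOn ha.le hy0 hy.1.le,
      logGap_strictMonoOn.monotoneOn hy0 (ha.le.trans hab) hy.2⟩
  have h := le_integral_exp_neg_mul_mul_sub n.cast_nonneg aestronglyMeasurable_logGap
    ae_logGap_nonneg integrableOn_gapKernel
    ((ae_restrict_mem measurableSet_Ioi).mono fun _ hy => gapKernel_nonneg hy)
    measurableSet_Ioc hgap
  have hsub : Set.Ioc a b ⊆ Set.Ioi 0 := fun _ hy => ha.trans hy.1
  rwa [Measure.restrict_restrict_of_subset hsub, integral_Ioc_gapKernel ha hab,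
    ← kappa_eq_integral hn, ← Nat.cast_succ, ← kappa_eq_integral n.succ_ne_zero] at h

end LaplaceIntegrals

section SmallArguments

theorem sqrt_add_lt_sqrt_add_of_sq_lt {a c d : ℝ} (ha : 0 ≤ a) (hd : 0 < d)
    (h : (c - d ^ 2) ^ 2 < 4 * d ^ 2 * a) : √(a + c) < √a + d := by
  have hcross : (c - d ^ 2) ^ 2 < (2 * d * √a) ^ 2 := by
    rw [mul_pow, Real.sq_sqrt ha]
    linarith
  have hlt : c - d ^ 2 < 2 * d * √a := lt_of_pow_lt_pow_left₀ 2 (by positivity) hcross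
  rw [Real.sqrt_lt' (by positivity), add_sq, Real.sq_sqrt ha]
  linarith

theorem sqrt_add_lt_sqrt_add_of_lt_sq {a c d : ℝ} (ha : 0 ≤ a) (hdc : d ^ 2 ≤ c)
    (h : 4 * d ^ 2 * a < (c - d ^ 2) ^ 2) : √a + d < √(a + c) := by
  have hcross : (2 * d * √a) ^ 2 < (c - d ^ 2) ^ 2 := by
    rw [mul_pow, Real.sq_sqrt ha]
    linarith
  have hlt : 2 * d * √a < c - d ^ 2 := lt_of_pow_lt_pow_left₀ 2 (sub_nonneg.2 hdc) hcross
  refine Real.lt_sqrt_of_sq_lt ?_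
  rw [add_sq, Real.sq_sqrt ha]
  linarith

theorem pi_mul_succ_div_two (n : ℕ) :
    Real.pi * (n + 1 : ℕ) / 2 = Real.pi * n / 2 + Real.pi / 2 := by
  push_cast
  ring

theorem delta_lt_delta_succ_of_sq_lt {n : ℕ} (hn : n ≠ 0) {d : ℝ}
    (hd : d = expectedComparisons (n + 1) - expectedComparisons n) (hd0 : 0 < d)
    (h : (Real.pi / 2 - d ^ 2) ^ 2 < 2 * d ^ 2 * (Real.pi * n)) : delta n < delta (n + 1) := by
  have hsqrt := sqrt_add_lt_sqrt_add_of_sq_lt (a := Real.pi * n / 2) (by positivity) hd0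
    (h.trans_eq (by ring))
  rw [delta_eq hn, delta_eq n.succ_ne_zero, pi_mul_succ_div_two]
  linarith

theorem delta_succ_lt_delta_of_lt_sq {n : ℕ} (hn : n ≠ 0) {d : ℝ}
    (hd : d = expectedComparisons (n + 1) - expectedComparisons n) (hdpi : d ^ 2 ≤ Real.pi / 2)
    (h : 2 * d ^ 2 * (Real.pi * n) < (Real.pi / 2 - d ^ 2) ^ 2) : delta (n + 1) < delta n := by
  have hsqrt := sqrt_add_lt_sqrt_add_of_lt_sq (a := Real.pi * n / 2) (by positivity) hdpi
    (lt_of_eq_of_lt (by ring) h)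
  rw [delta_eq hn, delta_eq n.succ_ne_zero, pi_mul_succ_div_two]
  linarith

theorem delta_lt_delta_succ {n : ℕ} (h1 : 1 ≤ n) (h7 : n ≤ 7) : delta n < delta (n + 1) := by
  obtain ⟨d, hd⟩ : ∃ d, d = expectedComparisons (n + 1) - expectedComparisons n := ⟨_, rfl⟩
  have hlo := Real.pi_gt_d20
  have hhi := Real.pi_lt_d20
  have hsq : 0 ≤ (Real.pi - 3.14159265358979323846) * (3.14159265358979323847 - Real.pi) :=
    mul_nonneg (by linarith) (by linarith)
  interval_cases n <;>
  · refine delta_lt_delta_succ_of_sq_lt (by norm_num) hd ?_ ?_ <;>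
      norm_num [expectedComparisons, distinctProb, Finset.sum_range_succ, Nat.descFactorial] at hd
    · norm_num [hd]
    · subst hd
      norm_num at hlo hhi ⊢
      linarith

theorem delta_succ_lt_delta_of_le_fifteen {n : ℕ} (h8 : 8 ≤ n) (h15 : n ≤ 15) :
    delta (n + 1) < delta n := by
  obtain ⟨d, hd⟩ : ∃ d, d = expectedComparisons (n + 1) - expectedComparisons n := ⟨_, rfl⟩
  have hlo := Real.pi_gt_d20
  have hhi := Real.pi_lt_d20
  have hsq : 0 ≤ (Real.pi - 3.14159265358979323846) ^ 2 := sq_nonneg _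
  interval_cases n <;>
  · refine delta_succ_lt_delta_of_lt_sq (by norm_num) hd ?_ ?_ <;>
    · norm_num [expectedComparisons, distinctProb, Finset.sum_range_succ, Nat.descFactorial] at hd
      subst hd
      norm_num at hlo hhi ⊢
      linarith

end SmallArguments

section LargeArguments

theorem two_mul_pow_self_le_succ_pow {n : ℕ} (hn : n ≠ 0) :
    2 * (n : ℝ) ^ n ≤ ((n + 1 : ℕ) : ℝ) ^ n :=
  calc 2 * (n : ℝ) ^ n = (1 + n * (1 / n : ℝ)) * (n : ℝ) ^ n := by field_simp; norm_num
    _ ≤ (1 + 1 / n : ℝ) ^ n * (n : ℝ) ^ n := by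
        gcongr
        exact one_add_mul_le_pow (by linarith [show (0 : ℝ) ≤ 1 / n by positivity]) n
    _ = ((n + 1 : ℕ) : ℝ) ^ n := by
        rw [← mul_pow, Nat.cast_succ]
        field_simp

theorem factorial_div_pow_self_succ_le {n : ℕ} (hn : n ≠ 0) :
    ((n + 1)! : ℝ) / ((n + 1 : ℕ) : ℝ) ^ (n + 1) ≤ 1 / 2 * ((n ! : ℝ) / (n : ℝ) ^ n) := by
  have hpow := two_mul_pow_self_le_succ_pow hn
  calc ((n + 1)! : ℝ) / ((n + 1 : ℕ) : ℝ) ^ (n + 1)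
      = (n ! : ℝ) / ((n + 1 : ℕ) : ℝ) ^ n := by
        rw [Nat.factorial_succ, pow_succ', Nat.cast_mul, mul_div_mul_left _ _ (by positivity)]
    _ ≤ (n ! : ℝ) / (2 * (n : ℝ) ^ n) := by gcongr
    _ = 1 / 2 * ((n ! : ℝ) / (n : ℝ) ^ n) := by ring

theorem factorial_div_pow_self_le {n : ℕ} (hn : 16 ≤ n) :
    (n ! : ℝ) / (n : ℝ) ^ n ≤ 1 / 2000 * (73 / 100) ^ n := by
  induction n, hn using Nat.le_induction with
  | base => norm_num [Nat.factorial]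
  | succ n hn ih =>
    calc ((n + 1)! : ℝ) / ((n + 1 : ℕ) : ℝ) ^ (n + 1)
        ≤ 1 / 2 * (1 / 2000 * (73 / 100) ^ n) :=
          (factorial_div_pow_self_succ_le (by omega)).trans (by gcongr)
      _ ≤ 73 / 100 * (1 / 2000 * (73 / 100) ^ n) := by
        linarith [pow_pos (show (0 : ℝ) < 73 / 100 by norm_num) n]
      _ = 1 / 2000 * (73 / 100) ^ (n + 1) := by ring

theorem pow_le_exp_neg_mul_logGap_one (n : ℕ) :
    (73 / 100 : ℝ) ^ n ≤ Real.exp (-(n * logGap 1)) := by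
  have hbase : Real.exp (-logGap 1) = 2 * Real.exp (-1) := by
    rw [logGap, one_add_one_eq_two, neg_sub, sub_eq_add_neg, Real.exp_add,
      Real.exp_log two_pos]
  rw [← mul_neg, Real.exp_nat_mul, hbase]
  gcongr
  linarith [Real.exp_neg_one_gt_d9]

theorem one_sub_exp_neg_logGap_quarter_gt :
    (0.025 : ℝ) < 1 - Real.exp (-logGap (1 / 4)) := by
  have hgap : (0.026 : ℝ) ≤ logGap (1 / 4) :=
    le_trans (by norm_num) (le_logGap (by norm_num))
  have hexp : Real.exp (-logGap (1 / 4)) ≤ 1.026⁻¹ := by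
    rw [Real.exp_neg]
    gcongr
    linarith [Real.add_one_le_exp (logGap (1 / 4))]
  norm_num at hexp ⊢
  linarith

theorem gapPrimitive_one_sub_quarter_gt :
    (0.022 : ℝ) < gapPrimitive 1 - gapPrimitive (1 / 4) := by
  have hone : 0.783 ≤ gaussCoord 1 := by
    refine Real.le_sqrt_of_sq_le ?_
    rw [logGap, one_add_one_eq_two]
    linarith [Real.log_two_lt_d9]
  have hquarter : gaussCoord (1 / 4) ≤ 0.2326 := by
    refine Real.sqrt_le_iff.2 ⟨by norm_num, ?_⟩
    linarith [logGap_le (y := 1 / 4) (by norm_num)]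
  have hinv_one : 1 / gaussCoord 1 ≤ 1 / 0.783 := by gcongr
  have hinv_quarter : 1 / 0.2326 ≤ 1 / gaussCoord (1 / 4) := by
    have := gaussCoord_pos (y := 1 / 4) (by norm_num)
    gcongr
  simp only [gapPrimitive]
  linarith

theorem lt_kappa_sub_kappa_succ {n : ℕ} (hn : n ≠ 0) :
    1 / 2000 * (73 / 100) ^ n < kappa n - kappa (n + 1) :=
  calc (1 / 2000 * (73 / 100) ^ n : ℝ) < (73 / 100) ^ n * 0.025 * 0.022 := by
        linarith [pow_pos (show (0 : ℝ) < 73 / 100 by norm_num) n]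
    _ ≤ Real.exp (-(n * logGap 1)) * (1 - Real.exp (-logGap (1 / 4))) *
          (gapPrimitive 1 - gapPrimitive (1 / 4)) := by
        have hquarter := sub_nonneg.1 (one_sub_exp_neg_logGap_quarter_gt.le.trans' (by norm_num))
        gcongr
        exacts [pow_le_exp_neg_mul_logGap_one n, one_sub_exp_neg_logGap_quarter_gt.le,
          gapPrimitive_one_sub_quarter_gt.le]
    _ ≤ kappa n - kappa (n + 1) := le_kappa_sub_kappa_succ hn (by norm_num) (by norm_num)

theorem delta_succ_lt_delta {n : ℕ} (hn : 8 ≤ n) : delta (n + 1) < delta n := by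
  rcases le_or_gt n 15 with h | h
  · exact delta_succ_lt_delta_of_le_fifteen hn h
  · have hkappa := lt_kappa_sub_kappa_succ (by omega : n ≠ 0)
    have hfactorial := factorial_div_pow_self_le (by omega : 16 ≤ n)
    have hpos : 0 < ((n + 1)! : ℝ) / ((n + 1 : ℕ) : ℝ) ^ (n + 1) := by positivity
    rw [delta, delta]
    linarith

end LargeArguments

end LinearTest

theorem theorem11 :
    (∀ (n : ℕ), 1 ≤ n →
      ∀ (Ω : Type*) [MeasurableSpace Ω] (P : Measure Ω) [IsProbabilityMeasure P]
        (x : Fin n → Ω → Fin n),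
        (∀ i, Measurable (x i)) →
        iIndepFun x P →
        (∀ i k, P.real {ω | x i ω = k} = 1 / (n : ℝ)) →
        ∀ (g₀ : Bool) (v₀ : Fin n → ℕ),
          ∫ ω, (LinearTest.runningTime g₀ v₀ (fun i => x i ω) : ℝ) ∂P =
            n + √(2 * Real.pi * n) + 7 / 3 + 2 * LinearTest.delta n) ∧
    Tendsto LinearTest.delta atTop (𝓝 0) ∧
    (∀ n : ℕ, 1 ≤ n → n ≤ 7 → LinearTest.delta (n + 1) > LinearTest.delta n) ∧
    (∀ n : ℕ, 8 ≤ n → LinearTest.delta (n + 1) < LinearTest.delta n) := by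
  refine ⟨fun n hn Ω _ P _ x hx hind hunif g₀ v₀ => ?_, LinearTest.tendsto_delta,
    fun n h1 h7 => LinearTest.delta_lt_delta_succ h1 h7,
    fun n hn => LinearTest.delta_succ_lt_delta hn⟩
  have hsqrt : √(2 * Real.pi * n) = 2 * √(Real.pi * n / 2) := by
    rw [show 2 * Real.pi * n = 2 ^ 2 * (Real.pi * n / 2) by ring,
      Real.sqrt_mul (by norm_num), Real.sqrt_sq (by norm_num)]
  rw [LinearTest.integral_runningTime hx hind hunif, LinearTest.delta_eq (by omega), hsqrt]
  ring
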